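/- Theorem (Choice of Baire space). Let $X$ and $Y$ be computable Polish spaces, i.e. complete metric spaces equipped with a dense sequence $\alpha:\mathbb{N}\to X$ (respectively $\alpha:\mathbb{N}\to Y$) such that the real numbers $d(\alpha(i),\alpha(j))$ are computable uniformly in $i,j$. Both are represented by their Cauchy representations: $p\in\mathbb{N}^{\mathbb{N}}$ is a name of $x$ if $d(\alpha(p(i)),\alpha(p(j)))<2^{-j}$ for all $i>j$ and $\alpha(p(n))\to x$. Let $f:X\to Y$ be a (total, single-valued) function. Then the following are equivalent: 1. $f\leq_{\mathrm W}\mathsf{C}_{\mathbb{N}^{\mathbb{N}}}$; 2. $f$ is effectively Borel measurable, i.e. $\mathrm{graph}(f)=\{(x,y)\in X\times Y: f(x)=y\}$ is an effective $\Sigma^1_1$ set. Here the following notions are used. A representation $\delta$ of a set $Z$ is a surjective partial function $\delta:\subseteq\mathbb{N}^{\mathbb{N}}\to Z$; Baire space $\mathbb{N}^{\mathbb{N}}$ is represented by the identity, and $\langle p,q\rangle$ is a name of $(u,v)$ in a product if $p$ and $q$ are names of $u$ and $v$. A partial function $F:\subseteq\mathbb{N}^{\mathbb{N}}\to\mathbb{N}^{\mathbb{N}}$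 realizes a partial multi-valued function $g$ between represented spaces if, for every name $p$ of a point $u\in\mathrm{dom}(g)$, $F(p)$ is defined and is a name of some element of $g(u)$. One writes $f\leq_{\mathrm W}g$ if there are computable partial functions $K,H:\subseteq\mathbb{N}^{\mathbb{N}}\to\mathbb{N}^{\mathbb{N}}$ such that $K\circ\langle\mathrm{id},G\circ H\rangle$ realizes $f$ for every realizer $G$ of $g$. For a represented space $Z$, $\mathcal{A}_-(Z)$ is the set of closed subsets of $Z$, where a name of $A$ is a function-space name of the characteristic function of $Z\setminus A$ as a continuous map into Sierpiński space $\{0,1\}$; in Sierpiński space $p$ is a name of $1$ if $p(n)=0$ for some $n$, and of $0$ otherwise. Closed sets with a computable name are called co-c.e. closed. Closed choice $\mathsf{C}_Z:\subseteq\mathcal{A}_-(Z)\rightrightarrows Z$, $A\mapsto A$, is the multi-valued function defined on the nonempty closed sets whose possible values at $A$ are exactly the points of $A$. A set $A\subseteq Z$ is an effective $\Sigma^1_1$ set if there is a co-c.e. closed $B\subseteq Z\times\mathbb{N}^{\mathbb{N}}$ such that $z\in A\iff(\exists p\in\mathbb{N}^{\mathbb{N}})\,(z,p)\in B$. -/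

import Mathlib

open Filter Topology

namespace ComputableAnalysis

/-! ### Computability on Baire space -/

/-- Baire space, the set of all sequences of natural numbers. -/
abbrev Baire : Type := ℕ → ℕ

/-- The word consisting of the first `n` entries of `p`. -/
def initSeg (p : Baire) (n : ℕ) : List ℕ := (List.range n).map p

/-- The word function `g` converges to `q` along the input `p`: every output `g (p|m)` is an
initial segment of `q`, and these outputs become arbitrarily long. -/
def ConvergesTo (g : List ℕ → List ℕ) (p q : Baire) : Prop :=
  (∀ m, g (initSeg p m) = initSeg q (g (initSeg p m)).length) ∧
    ∀ k, ∃ m, k < (g (initSeg p m)).length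

theorem ConvergesTo.unique {g : List ℕ → List ℕ} {p q r : Baire}
    (hq : ConvergesTo g p q) (hr : ConvergesTo g p r) : q = r := by
  funext k
  obtain ⟨m, hm⟩ := hq.2 k
  have h : initSeg q (g (initSeg p m)).length = initSeg r (g (initSeg p m)).length :=
    (hq.1 m).symm.trans (hr.1 m)
  exact List.map_inj_left.1 h k (List.mem_range.2 hm)

open Classical in
/-- The partial function on Baire space that is approximated by the word function `g`: from longer
and longer initial segments of the input it produces longer and longer initial segments of the
output. It is defined on `p` if and only if `g` converges along `p` to some infinite sequence. -/
noncomputable def limitFun (g : List ℕ → List ℕ) : Baire →. Baire := fun p =>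
  ⟨∃ q, ConvergesTo g p q, fun h => h.choose⟩

theorem mem_limitFun {g : List ℕ → List ℕ} {p q : Baire} :
    q ∈ limitFun g p ↔ ConvergesTo g p q := by
  constructor
  · rintro ⟨h, rfl⟩
    exact h.choose_spec
  · intro h
    exact ⟨⟨q, h⟩, ConvergesTo.unique (Exists.choose_spec (⟨q, h⟩ : ∃ q, ConvergesTo g p q)) h⟩

/-- A partial function on Baire space is computable if it is approximated by a computable
word function. -/
def IsComputableFun (F : Baire →. Baire) : Prop :=
  ∃ g : List ℕ → List ℕ, Computable g ∧ F = limitFun g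

/-- The standard representation `p ↦ η_p` of the continuous partial functions on Baire space
(with `G_δ` domain): `p` lists the values of an approximating word function. -/
noncomputable def eta (p : Baire) : Baire →. Baire :=
  limitFun fun w => Denumerable.ofNat (List ℕ) (p (Encodable.encode w))

/-- The pairing `⟨p, q⟩ = p(0) q(0) p(1) q(1) …` on Baire space. -/
def pair (p q : Baire) : Baire := fun n => if n % 2 = 0 then p (n / 2) else q (n / 2)

/-- The first projection of the pairing. -/
def unpairFst (r : Baire) : Baire := fun n => r (2 * n)

/-- The second projection of the pairing. -/
def unpairSnd (r : Baire) : Baire := fun n => r (2 * n + 1)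

theorem unpairFst_pair (p q : Baire) : unpairFst (pair p q) = p := by
  funext n
  simp [unpairFst, pair]

theorem unpairSnd_pair (p q : Baire) : unpairSnd (pair p q) = q := by
  funext n
  have h1 : (2 * n + 1) % 2 = 1 := by omega
  have h2 : (2 * n + 1) / 2 = n := by omega
  simp [unpairSnd, pair, h1, h2]

/-! ### Represented spaces, realizers and Weihrauch reducibility -/

/-- A representation of `X`, i.e. a surjective partial function `δ` from Baire space to `X`, given
by its graph: `δ.Names p x` means that `p` is in the domain of `δ` and `δ(p) = x`. -/
structure SetRepresentation (X : Type*) where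
  Names : Baire → X → Prop
  unique : ∀ p x y, Names p x → Names p y → x = y
  surjective : ∀ x, ∃ p, Names p x

/-- A point is computable if it has a computable name. -/
def IsComputablePoint {X : Type*} (δ : SetRepresentation X) (x : X) : Prop :=
  ∃ p : Baire, Computable p ∧ δ.Names p x

/-- `F` is a realizer of the partial multi-valued function `f`. Such a function is given by its sets
of values; its domain consists of the points at which this set is nonempty. -/
def Realizes {X Y : Type*} (δX : SetRepresentation X) (δY : SetRepresentation Y) (F : Baire →. Baire) (f : X → Set Y) :
    Prop :=
  ∀ p x, δX.Names p x → (f x).Nonempty → ∃ q ∈ F p, ∃ y ∈ f x, δY.Names q y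

/-- The partial function `K ∘ ⟨id, G ∘ H⟩` on Baire space. -/
def reductionComp (K G H : Baire →. Baire) : Baire →. Baire := fun p =>
  (H p).bind fun r => (G r).bind fun s => K (pair p s)

/-- Weihrauch reducibility of partial multi-valued functions on represented spaces. -/
def WeihrauchLE {X Y U V : Type*} (δX : SetRepresentation X) (δY : SetRepresentation Y) (δU : SetRepresentation U) (δV : SetRepresentation V)
    (f : X → Set Y) (g : U → Set V) : Prop :=
  ∃ K H : Baire →. Baire, IsComputableFun K ∧ IsComputableFun H ∧
    ∀ G : Baire →. Baire, Realizes δU δV G g → Realizes δX δY (reductionComp K G H) f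

/-- A total single-valued function, regarded as a multi-valued one. -/
def single {X Y : Type*} (f : X → Y) : X → Set Y := fun x => {f x}

/-- Baire space is represented by the identity. -/
def baireRepr : SetRepresentation Baire where
  Names p x := p = x
  unique := fun _ _ _ h₁ h₂ => h₁.symm.trans h₂
  surjective := fun x => ⟨x, rfl⟩

/-- The product representation: `⟨p, q⟩` is a name of `(x, y)` if `p` and `q` are names of `x`
and `y`. -/
def prodRepr {X Y : Type*} (δX : SetRepresentation X) (δY : SetRepresentation Y) : SetRepresentation (X × Y) where
  Names r z := δX.Names (unpairFst r) z.1 ∧ δY.Names (unpairSnd r) z.2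
  unique := fun _ _ _ h₁ h₂ =>
    Prod.ext (δX.unique _ _ _ h₁.1 h₂.1) (δY.unique _ _ _ h₁.2 h₂.2)
  surjective := fun z => by
    obtain ⟨p, hp⟩ := δX.surjective z.1
    obtain ⟨q, hq⟩ := δY.surjective z.2
    exact ⟨pair p q, by rwa [unpairFst_pair], by rwa [unpairSnd_pair]⟩

/-- Sierpinski space, with `True` as its open point, is represented by
`δ(p) = True ↔ ∃ n, p n = 0`. -/
def sierpinskiRepr : SetRepresentation Prop where
  Names p s := (∃ n, p n = 0) = s
  unique := fun _ _ _ h₁ h₂ => h₁.symm.trans h₂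
  surjective := fun s => by
    by_cases h : s
    · exact ⟨fun _ => 0, by simp [h]⟩
    · exact ⟨fun _ => 1, by simp [h]⟩

/-! ### Closed sets with negative information and closed choice -/

/-- `δ^∘(p) = U`: `p` is a name, in the function space representation, of the characteristic
function of `U` with values in Sierpinski space. -/
def NamesOpen {X : Type*} (δ : SetRepresentation X) (p : Baire) (U : Set X) : Prop :=
  Realizes δ sierpinskiRepr (eta p) (single fun x => x ∈ U)

theorem NamesOpen.unique {X : Type*} {δ : SetRepresentation X} {p : Baire} {U V : Set X}
    (hU : NamesOpen δ p U) (hV : NamesOpen δ p V) : U = V := by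
  ext x
  obtain ⟨n, hn⟩ := δ.surjective x
  obtain ⟨q, hq, s, rfl, hs⟩ := hU n x hn ⟨_, rfl⟩
  obtain ⟨q', hq', s', rfl, hs'⟩ := hV n x hn ⟨_, rfl⟩
  obtain rfl := Part.mem_unique hq hq'
  exact iff_of_eq (sierpinskiRepr.unique _ _ _ hs hs')

/-- The closed subsets of a represented space: the complements of the sets whose characteristic
function into Sierpinski space is continuous, i.e. has a name. -/
def ClosedSets {X : Type*} (δ : SetRepresentation X) : Type _ :=
  {A : Set X // ∃ p, NamesOpen δ p Aᶜ}

/-- The representation `ψ₋` of the closed sets by negative information. -/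
def negRepr {X : Type*} (δ : SetRepresentation X) : SetRepresentation (ClosedSets δ) where
  Names p A := NamesOpen δ p A.1ᶜ
  unique := fun _ _ _ h₁ h₂ => Subtype.ext (compl_injective (h₁.unique h₂))
  surjective := fun A => A.2

/-- A subset is co-c.e. closed if it is a computable point in the space of closed sets. -/
def IsCoCEClosed {X : Type*} (δ : SetRepresentation X) (A : Set X) : Prop :=
  ∃ h : ∃ p, NamesOpen δ p Aᶜ, IsComputablePoint (negRepr δ) (⟨A, h⟩ : ClosedSets δ)

/-- Closed choice `C_X : A ↦ A`, whose domain consists of the nonempty closed sets. -/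
def closedChoice {X : Type*} (δ : SetRepresentation X) : ClosedSets δ → Set X := fun A => A.1

/-! ### Computable Polish spaces -/

/-- A computable Polish space: a complete metric space with a dense sequence `α` such that the
distances `d(α(i), α(j))` are computable real numbers, uniformly in `i` and `j`. -/
structure ComputablePolishSpace (X : Type*) [MetricSpace X] where
  complete : CompleteSpace X
  α : ℕ → X
  dense : DenseRange α
  dist_computable : ∃ g : ℕ × ℕ × ℕ → ℕ × ℕ, Computable g ∧ ∀ i j k : ℕ,
    |dist (α i) (α j) - ((g (i, j, k)).1 : ℝ) / (((g (i, j, k)).2 : ℝ) + 1)| ≤ (1 / 2 : ℝ) ^ k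

/-- The Cauchy representation: `p` is a name of `x` if the sequence `α(p(n))` converges rapidly
to `x`. -/
def cauchyRepr {X : Type*} [MetricSpace X] (c : ComputablePolishSpace X) : SetRepresentation X where
  Names p x := (∀ i j, j < i → dist (c.α (p i)) (c.α (p j)) < (1 / 2 : ℝ) ^ j) ∧
    Tendsto (fun n => c.α (p n)) atTop (𝓝 x)
  unique := fun _ _ _ h₁ h₂ => tendsto_nhds_unique h₁.2 h₂.2
  surjective := fun x => by
    have h : ∀ n : ℕ, ∃ i, dist x (c.α i) < (1 / 2 : ℝ) ^ (n + 1) := fun n =>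
      c.dense.exists_dist_lt x (by positivity)
    choose p hp using h
    refine ⟨p, fun i j hij => ?_, ?_⟩
    · have h1 : (1 / 2 : ℝ) ^ (i + 1) ≤ (1 / 2 : ℝ) ^ (j + 1) :=
        pow_le_pow_of_le_one (by norm_num) (by norm_num) (by omega)
      have h2 := dist_triangle_left (c.α (p i)) (c.α (p j)) x
      have h3 : (1 / 2 : ℝ) ^ (j + 1) = (1 / 2 : ℝ) ^ j / 2 := by ring
      linarith [hp i, hp j]
    · rw [tendsto_iff_dist_tendsto_zero]
      have h0 : Tendsto (fun n : ℕ => (1 / 2 : ℝ) ^ (n + 1)) atTop (𝓝 0) :=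
        (tendsto_pow_atTop_nhds_zero_of_lt_one (by norm_num) (by norm_num)).comp
          (tendsto_add_atTop_nat 1)
      refine squeeze_zero (fun _ => dist_nonneg) (fun n => ?_) h0
      rw [dist_comm]
      exact (hp n).le

/-- `A` is an effective `Σ¹₁` set: the projection of a co-c.e. closed subset of `X × ℕ^ℕ`. -/
def IsEffectiveSigma11 {X : Type*} (δ : SetRepresentation X) (A : Set X) : Prop :=
  ∃ B : Set (X × Baire), IsCoCEClosed (prodRepr δ baireRepr) B ∧
    ∀ x, x ∈ A ↔ ∃ p : Baire, (x, p) ∈ B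

/-- A function on computable Polish spaces is effectively Borel measurable if its graph is an
effective `Σ¹₁` set. -/
def IsEffectivelyBorelMeasurable {X Y : Type*} [MetricSpace X] [MetricSpace Y]
    (cX : ComputablePolishSpace X) (cY : ComputablePolishSpace Y) (f : X → Y) : Prop :=
  IsEffectiveSigma11 (prodRepr (cauchyRepr cX) (cauchyRepr cY)) {z : X × Y | f z.1 = z.2}

end ComputableAnalysis

open ComputableAnalysis

/-! Suppose `f` reduces to closed choice via word functions `k` and `h`. Then `y = f x` iff there
are a name `p` of `x` and a sequence `s` in the closed set described by `h` along `p` such that all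
outputs of `k` along `⟨p, s⟩` are consistent with `y`. Every member of the set is a possible answer
of closed choice (`exists_of_realizes_closedChoice`), so any such `s` makes `k` produce a name of `f
x`. Each clause is refutable from finitely many entries of names, so the witnesses form a co-c.e.
closed set (`isCoCEClosed_reductionGraph`).

Conversely, let the graph be the projection of a co-c.e. closed `B`. From a name `p` of `x` one
computes negative information on the set of all `⟨q, r⟩` with `q` rapidly Cauchy and `((p, q), r)`
not rejected by `B`. It is nonempty; by completeness, `q` names some `y` for every member, and
membership in `B` forces `y = f x`. So the outer reduction reads off `q`.

Being a Cauchy name involves strict inequalities. Both directions replace it by closed conditions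
with smaller constants, which still imply it. Semidecidable conditions become names of open sets
through `ComputableFunctional.exists_name`, and are read back from such names through
`NamesOpen.mem_iff`. -/

namespace ComputableAnalysis

/-! ### Computable functionals with a modulus that does not depend on the sequence argument -/

/-- The sequence that starts with the word `w` and continues with zeros. -/
def extendZero (w : List ℕ) : Baire := fun n => w.getD n 0

theorem extendZero_initSeg (p : Baire) {n i : ℕ} (h : i < n) :
    extendZero (initSeg p n) i = p i := by
  simp [extendZero, initSeg, h]

theorem length_initSeg (p : Baire) (n : ℕ) : (initSeg p n).length = n := by
  simp [initSeg]

/-- `Φ u a` is computable from `a` and from an initial segment of `u` whose length is computable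
from `a` alone. -/
def ComputableFunctional {α β : Type*} [Primcodable α] [Primcodable β] (Φ : Baire → α → β) : Prop :=
  Computable (fun z : List ℕ × α => Φ (extendZero z.1) z.2) ∧
    ∃ μ : α → ℕ, Computable μ ∧ ∀ (u v : Baire) (a : α), (∀ i < μ a, u i = v i) → Φ u a = Φ v a

theorem computable_rangeMap {α β : Type*} [Primcodable α] [Primcodable β] {f : α → ℕ → β}
    {n : α → ℕ} (hf : Computable₂ f) (hn : Computable n) :
    Computable fun a => (List.range (n a)).map (f a) := by
  have h : Computable fun a =>
      (Nat.rec [] (fun k l => l ++ [f a k]) (n a) : List β) := by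
    refine Computable.nat_rec (h := fun a z => z.2 ++ [f a z.1]) hn (Computable.const []) ?_
    exact Computable.list_concat.comp (Computable.snd.comp Computable.snd)
      (hf.comp Computable.fst (Computable.fst.comp Computable.snd))
  refine h.of_eq fun a => ?_
  induction n a with
  | zero => rfl
  | succ k ih => simp [List.range_succ, ← ih]

/-- The maximum of `f 0`, …, `f (n - 1)`. -/
def boundBelow (f : ℕ → ℕ) (n : ℕ) : ℕ := Nat.rec 0 (fun k m => max m (f k)) n

theorem le_boundBelow (f : ℕ → ℕ) {n i : ℕ} (h : i < n) : f i ≤ boundBelow f n := by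
  induction n with
  | zero => omega
  | succ k ih =>
    rcases Nat.lt_succ_iff_lt_or_eq.1 h with h | rfl
    · exact (ih h).trans (le_max_left _ _)
    · exact le_max_right _ _

theorem computable_boundBelow {α : Type*} [Primcodable α] {f : α → ℕ → ℕ} {n : α → ℕ}
    (hf : Computable₂ f) (hn : Computable n) : Computable fun a => boundBelow (f a) (n a) := by
  refine Computable.nat_rec (h := fun a z => max z.2 (f a z.1)) hn (Computable.const 0) ?_
  exact Primrec.nat_max.to_comp.comp (Computable.snd.comp Computable.snd)
    (hf.comp Computable.fst (Computable.fst.comp Computable.snd))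

namespace ComputableFunctional

variable {α β γ : Type*} [Primcodable α] [Primcodable β] [Primcodable γ]

theorem of_computable {f : α → β} (hf : Computable f) :
    ComputableFunctional fun _ a => f a :=
  ⟨hf.comp Computable.snd, fun _ => 0, Computable.const 0, fun _ _ _ _ => rfl⟩

theorem of_eq {Φ Ψ : Baire → α → β} (hΦ : ComputableFunctional Φ) (h : ∀ u a, Φ u a = Ψ u a) :
    ComputableFunctional Ψ := by
  obtain rfl : Φ = Ψ := funext fun u => funext fun a => h u a
  exact hΦ

theorem map {f : β → γ} {Φ : Baire → α → β} (hf : Computable f) (hΦ : ComputableFunctional Φ) :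
    ComputableFunctional fun u a => f (Φ u a) := by
  obtain ⟨h, μ, hμ, hm⟩ := hΦ
  exact ⟨hf.comp h, μ, hμ, fun u v a huv => congrArg f (hm u v a huv)⟩

theorem prodMk {Φ : Baire → α → β} {Ψ : Baire → α → γ} (hΦ : ComputableFunctional Φ)
    (hΨ : ComputableFunctional Ψ) : ComputableFunctional fun u a => (Φ u a, Ψ u a) := by
  obtain ⟨h, μ, hμ, hm⟩ := hΦ
  obtain ⟨h', ν, hν, hn⟩ := hΨ
  refine ⟨h.pair h', fun a => max (μ a) (ν a), Primrec.nat_max.to_comp.comp hμ hν,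
    fun u v a huv => Prod.ext (hm u v a fun i hi => huv i ?_) (hn u v a fun i hi => huv i ?_)⟩
  · exact hi.trans_le (le_max_left _ _)
  · exact hi.trans_le (le_max_right _ _)

theorem map₂ {δ : Type*} [Primcodable δ] {f : β → γ → δ} {Φ : Baire → α → β} {Ψ : Baire → α → γ}
    (hf : Computable₂ f) (hΦ : ComputableFunctional Φ) (hΨ : ComputableFunctional Ψ) :
    ComputableFunctional fun u a => f (Φ u a) (Ψ u a) :=
  map (f := fun z : β × γ => f z.1 z.2) hf (hΦ.prodMk hΨ)

theorem reindex {g : γ → α} {Φ : Baire → α → β} (hΦ : ComputableFunctional Φ) (hg : Computable g) :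
    ComputableFunctional fun u c => Φ u (g c) := by
  obtain ⟨h, μ, hμ, hm⟩ := hΦ
  exact ⟨h.comp (Computable.fst.pair (hg.comp Computable.snd)), fun c => μ (g c), hμ.comp hg,
    fun u v c huv => hm u v (g c) huv⟩

theorem eval {i : α → ℕ} (hi : Computable i) : ComputableFunctional fun u a => u (i a) :=
  ⟨(Primrec.list_getD 0).to_comp.comp Computable.fst (hi.comp Computable.snd),
    fun a => i a + 1, Computable.succ.comp hi, fun _ _ _ huv => huv _ (Nat.lt_succ_self _)⟩

theorem rangeMap {Φ : Baire → α × ℕ → β} {n : α → ℕ} (hΦ : ComputableFunctional Φ)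
    (hn : Computable n) :
    ComputableFunctional fun u a => (List.range (n a)).map fun i => Φ u (a, i) := by
  obtain ⟨h, μ, hμ, hm⟩ := hΦ
  have hf : Computable₂ fun (z : List ℕ × α) (i : ℕ) => Φ (extendZero z.1) (z.2, i) :=
    Computable.comp (f := fun z : List ℕ × α × ℕ => Φ (extendZero z.1) z.2)
      (g := fun z : (List ℕ × α) × ℕ => (z.1.1, z.1.2, z.2)) h
      ((Computable.fst.comp Computable.fst).pair ((Computable.snd.comp Computable.fst).pair Computable.snd))
  have hn' : Computable fun z : List ℕ × α => n z.2 := hn.comp Computable.snd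
  refine ⟨computable_rangeMap hf hn',
    fun a => boundBelow (fun i => μ (a, i)) (n a), ?_, fun u v a huv => ?_⟩
  · exact computable_boundBelow (f := fun a i => μ (a, i)) hμ hn
  · refine List.map_congr_left fun i hi => hm u v (a, i) fun j hj => huv j (hj.trans_le ?_)
    exact le_boundBelow (fun i => μ (a, i)) (List.mem_range.1 hi)

theorem wordOf {Ψ : Baire → α × ℕ → ℕ} {n : α → ℕ} (hΨ : ComputableFunctional Ψ)
    (hn : Computable n) :
    ComputableFunctional fun u a => initSeg (fun i => Ψ u (a, i)) (n a) :=
  hΨ.rangeMap hn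

/-- Substitution of a computable functional for the sequence argument. -/
theorem subst {Φ : Baire → α → β} {Ψ : Baire → α × ℕ → ℕ} (hΦ : ComputableFunctional Φ)
    (hΨ : ComputableFunctional Ψ) :
    ComputableFunctional fun u a => Φ (fun n => Ψ u (a, n)) a := by
  obtain ⟨h, μ, hμ, hm⟩ := hΦ
  refine (map h ((hΨ.wordOf hμ).prodMk (of_computable Computable.id))).of_eq fun u a => ?_
  exact hm _ _ a fun i hi => extendZero_initSeg _ hi

theorem interleave {Φ Ψ : Baire → α × ℕ → ℕ} (hΦ : ComputableFunctional Φ)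
    (hΨ : ComputableFunctional Ψ) :
    ComputableFunctional fun u (z : α × ℕ) =>
      pair (fun n => Φ u (z.1, n)) (fun n => Ψ u (z.1, n)) z.2 := by
  have h2 : Computable fun z : α × ℕ => (z.1, z.2 / 2) :=
    Computable.fst.pair (Primrec.nat_div.to_comp.comp Computable.snd (Computable.const 2))
  have hb : Computable fun z : α × ℕ => decide (z.2 % 2 = 0) :=
    Primrec.eq.decide.to_comp.comp
      (Primrec.nat_mod.to_comp.comp Computable.snd (Computable.const 2)) (Computable.const 0)
  have hc : Computable fun z : Bool × ℕ × ℕ => bif z.1 then z.2.1 else z.2.2 :=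
    Computable.cond Computable.fst (Computable.fst.comp Computable.snd)
      (Computable.snd.comp Computable.snd)
  refine (((of_computable hb).prodMk ((hΦ.reindex h2).prodMk (hΨ.reindex h2))).map hc).of_eq
    fun p z => ?_
  by_cases h : z.2 % 2 = 0 <;> simp [pair, h]

end ComputableFunctional

/-! ### Total functionals as computable partial functions -/

/-- The number of steps `k < n` before the first one with `b < μ k`. -/
def stepsWithin (μ : ℕ → ℕ) (b n : ℕ) : ℕ :=
  Nat.rec 0 (fun k l => bif decide (l = k) && decide (μ k ≤ b) then k + 1 else l) n

theorem stepsWithin_succ (μ : ℕ → ℕ) (b n : ℕ) :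
    stepsWithin μ b (n + 1) =
      bif decide (stepsWithin μ b n = n) && decide (μ n ≤ b) then n + 1 else stepsWithin μ b n :=
  rfl

theorem stepsWithin_le (μ : ℕ → ℕ) (b n : ℕ) : stepsWithin μ b n ≤ n := by
  induction n with
  | zero => exact le_rfl
  | succ n ih =>
    rw [stepsWithin_succ]
    cases decide (stepsWithin μ b n = n) && decide (μ n ≤ b)
    · exact ih.trans n.le_succ
    · exact le_rfl

theorem le_of_lt_stepsWithin {μ : ℕ → ℕ} {b n k : ℕ} (h : k < stepsWithin μ b n) : μ k ≤ b := by
  induction n with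
  | zero => exact absurd h (Nat.not_lt_zero k)
  | succ n ih =>
    rw [stepsWithin_succ] at h
    by_cases hc : stepsWithin μ b n = n ∧ μ n ≤ b
    · simp only [hc.1, hc.2, decide_true, Bool.and_true, cond_true] at h
      rcases Nat.lt_succ_iff_lt_or_eq.1 h with h | rfl
      · exact ih (hc.1.symm ▸ h)
      · exact hc.2
    · have hc' : (decide (stepsWithin μ b n = n) && decide (μ n ≤ b)) = false := by
        simpa using hc
      rw [hc', cond_false] at h
      exact ih h

theorem le_stepsWithin {μ : ℕ → ℕ} {b n j : ℕ} (hj : ∀ k < j, μ k ≤ b) (hn : j ≤ n) :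
    j ≤ stepsWithin μ b n := by
  have key : ∀ j ≤ n, (∀ k < j, μ k ≤ b) → stepsWithin μ b j = j := by
    intro j
    induction j with
    | zero => exact fun _ _ => rfl
    | succ j ih =>
      intro hj h
      rw [stepsWithin_succ, ih (by omega) fun k hk => h k (by omega)]
      simp [h j (by omega)]
  have mono : ∀ n, stepsWithin μ b n ≤ stepsWithin μ b (n + 1) := by
    intro n
    rw [stepsWithin_succ]
    cases decide (stepsWithin μ b n = n) && decide (μ n ≤ b)
    · exact le_rfl
    · exact (stepsWithin_le μ b n).trans n.le_succ
  exact (key j hn hj).symm.le.trans (monotone_nat_of_le_succ mono hn)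

theorem computable_stepsWithin {μ : ℕ → ℕ} (hμ : Computable μ) :
    Computable fun b => stepsWithin μ b b := by
  refine Computable.nat_rec
    (h := fun b z => bif decide (z.2 = z.1) && decide (μ z.1 ≤ b) then z.1 + 1 else z.2)
    Computable.id (Computable.const 0) ?_
  have h1 : Computable fun z : ℕ × ℕ × ℕ => z.2.1 := Computable.fst.comp Computable.snd
  have h2 : Computable fun z : ℕ × ℕ × ℕ => z.2.2 := Computable.snd.comp Computable.snd
  exact Computable.cond
    (Primrec.and.to_comp.comp (Primrec.eq.decide.to_comp.comp h2 h1)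
      (Primrec.nat_le.decide.to_comp.comp (hμ.comp h1) Computable.fst))
    (Computable.succ.comp h1) h2

theorem limitFun_eq_some {g : List ℕ → List ℕ} {p q : Baire} (h : ConvergesTo g p q) :
    limitFun g p = Part.some q :=
  Part.eq_some_iff.2 (mem_limitFun.2 h)

/-- A word of length `b` determines every entry whose modulus is at most `b`; the approximating word
function outputs the longest initial block of such entries. -/
theorem ComputableFunctional.isComputableFun {Φ : Baire → ℕ → ℕ} (hΦ : ComputableFunctional Φ) :
    IsComputableFun fun p => Part.some (Φ p) := by
  obtain ⟨h, μ, hμ, hm⟩ := hΦ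
  have hl : Computable fun w : List ℕ => stepsWithin μ w.length w.length :=
    (computable_stepsWithin hμ).comp Computable.list_length
  refine ⟨fun w => (List.range (stepsWithin μ w.length w.length)).map (Φ (extendZero w)),
    computable_rangeMap h hl, funext fun p => (limitFun_eq_some ⟨fun m => ?_, fun k => ?_⟩).symm⟩
  · simp only [length_initSeg, List.length_map, List.length_range]
    refine List.map_congr_left fun i hi => hm _ _ i fun j hj => extendZero_initSeg p ?_
    exact hj.trans_le (le_of_lt_stepsWithin (List.mem_range.1 hi))
  · refine ⟨max (k + 1) (boundBelow μ (k + 1)), ?_⟩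
    simp only [length_initSeg, List.length_map, List.length_range]
    refine Nat.lt_of_succ_le (le_stepsWithin (fun i hi => ?_) (le_max_left _ _))
    exact (le_boundBelow μ hi).trans (le_max_right _ _)

/-! ### Effectively open sets -/

theorem computable_ofNat_list : Computable (Denumerable.ofNat (List ℕ)) := Computable.ofNat _

/-- A semidecidable relation between `p` and `s` is uniformly given by names of open sets of
sequences `s`. -/
theorem ComputableFunctional.exists_name {T : Baire → ℕ → Bool} (hT : ComputableFunctional T) :
    ∃ Φ : Baire → ℕ → ℕ, ComputableFunctional Φ ∧ ∀ p s, ∃ q ∈ eta (Φ p) s,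
      ((∃ n, q n = 0) ↔ ∃ e, T (pair p s) e = true) := by
  obtain ⟨-, μ, hμ, hm⟩ := id hT
  -- The number `m` codes a candidate witness in its first component and also serves as the bound on
  -- the modulus. The guard makes entry `m` depend only on `s` below `m`, so a word of length `n`
  -- yields `n` output entries.
  let D : Baire → Baire → ℕ → ℕ := fun p s m =>
    bif decide (μ m.unpair.1 ≤ m) && T (pair p s) m.unpair.1 then 0 else 1
  have hD : ∀ p s n m, m < n → D p (extendZero (initSeg s n)) m = D p s m := by
    intro p s n m hmn
    by_cases hμm : μ m.unpair.1 ≤ m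
    · have : T (pair p (extendZero (initSeg s n))) m.unpair.1 = T (pair p s) m.unpair.1 := by
        refine hm _ _ _ fun i hi => ?_
        have hi' : i / 2 < n := by omega
        simp only [pair, extendZero_initSeg s hi']
      simp only [D, this]
    · simp [D, hμm]
  let Φ : Baire → ℕ → ℕ := fun p k =>
    let w := Denumerable.ofNat (List ℕ) k
    Encodable.encode ((List.range w.length).map (D p (extendZero w)))
  refine ⟨Φ, ?_, fun p s => ⟨D p s, mem_limitFun.2 ⟨fun m => ?_, fun k => ⟨k + 1, ?_⟩⟩, ?_⟩⟩
  · have hw : Computable fun z : ℕ × ℕ => Denumerable.ofNat (List ℕ) z.1 :=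
      computable_ofNat_list.comp Computable.fst
    have hpair : ComputableFunctional fun (p : Baire) (z : (ℕ × ℕ) × ℕ) =>
        pair p (extendZero (Denumerable.ofNat (List ℕ) z.1.1)) z.2 := by
      have hx : Computable fun z : (ℕ × ℕ) × ℕ =>
          extendZero (Denumerable.ofNat (List ℕ) z.1.1) z.2 :=
        (Primrec.list_getD 0).to_comp.comp (hw.comp Computable.fst) Computable.snd
      exact (eval Computable.snd).interleave (of_computable hx)
    have he : Computable fun z : ℕ × ℕ => z.2.unpair.1 :=
      Computable.fst.comp (Computable.unpair.comp Computable.snd)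
    have hTT := (hT.reindex he).subst hpair
    have hle : Computable fun z : ℕ × ℕ => decide (μ z.2.unpair.1 ≤ z.2) :=
      Primrec.nat_le.decide.to_comp.comp (hμ.comp he) Computable.snd
    have hand := map₂ Primrec.and.to_comp (of_computable hle) hTT
    have hc : Computable fun b : Bool => bif b then 0 else 1 :=
      Computable.cond Computable.id (Computable.const 0) (Computable.const 1)
    exact ((hand.map hc).rangeMap (Computable.list_length.comp computable_ofNat_list)).map
      Computable.encode
  · simp only [Φ, Denumerable.ofNat_encode, length_initSeg, List.length_map, List.length_range]
    exact List.map_congr_left fun i hi => hD p s m i (List.mem_range.1 hi)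
  · simp [Φ, length_initSeg]
  · have hz : ∀ m, D p s m = 0 ↔ μ m.unpair.1 ≤ m ∧ T (pair p s) m.unpair.1 = true := by
      intro m
      by_cases h : μ m.unpair.1 ≤ m <;> cases h' : T (pair p s) m.unpair.1 <;> simp [D, h, h']
    simp only [hz]
    constructor
    · rintro ⟨m, -, h⟩
      exact ⟨_, h⟩
    · rintro ⟨e, h⟩
      -- The second component pads the code of `e` to at least `μ e`, so the guard is met.
      refine ⟨Nat.pair e (μ e), ?_, ?_⟩
      · rw [Nat.unpair_pair]
        exact Nat.right_le_pair _ _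
      · rwa [Nat.unpair_pair]

/-- Replaces an arbitrary type of witnesses by the natural numbers. -/
theorem ComputableFunctional.exists_nat {α : Type*} [Primcodable α] {T : Baire → α → Bool}
    (hT : ComputableFunctional T) : ∃ T' : Baire → ℕ → Bool, ComputableFunctional T' ∧
      ∀ u, (∃ e, T' u e = true) ↔ ∃ a, T u a = true := by
  obtain ⟨h, μ, hμ, hm⟩ := hT
  refine ⟨fun u e => Option.casesOn (Encodable.decode (α := α) e) false (T u), ⟨?_,
    fun e => Option.casesOn (Encodable.decode (α := α) e) 0 μ, ?_, fun u v e huv => ?_⟩,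
    fun u => ⟨?_, ?_⟩⟩
  · refine Computable.option_casesOn (o := fun z : List ℕ × ℕ => Encodable.decode (α := α) z.2)
      (g := fun (z : List ℕ × ℕ) a => T (extendZero z.1) a)
      (Computable.decode.comp Computable.snd) (Computable.const false) ?_
    exact Computable.comp (f := fun z : List ℕ × α => T (extendZero z.1) z.2)
      (g := fun z : (List ℕ × ℕ) × α => (z.1.1, z.2)) h
      ((Computable.fst.comp Computable.fst).pair Computable.snd)
  · exact Computable.option_casesOn (o := fun e : ℕ => Encodable.decode (α := α) e)
      (g := fun (_ : ℕ) a => μ a) Computable.decode (Computable.const 0) (hμ.comp Computable.snd)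
  · beta_reduce at huv ⊢
    revert huv
    cases Encodable.decode (α := α) e with
    | none => exact fun _ => rfl
    | some a => exact fun huv => hm u v a huv
  · rintro ⟨e, he⟩
    beta_reduce at he
    revert he
    cases Encodable.decode (α := α) e with
    | none => exact fun he => absurd he Bool.false_ne_true
    | some a => exact fun he => ⟨a, he⟩
  · rintro ⟨a, ha⟩
    refine ⟨Encodable.encode a, ?_⟩
    simpa using ha

/-! ### Approximating word functions -/

/-- All outputs are initial segments of the limit, so one occurrence at a position settles the
value. This turns statements about the limit into searches over finite words. -/
theorem ConvergesTo.exists_getElem?_iff {g : List ℕ → List ℕ} {p q : Baire}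
    (h : ConvergesTo g p q) {i c : ℕ} : (∃ m, (g (initSeg p m))[i]? = some c) ↔ q i = c := by
  have hval : ∀ m, i < (g (initSeg p m)).length → (g (initSeg p m))[i]? = some (q i) := by
    intro m hi
    rw [h.1 m]
    unfold initSeg at hi ⊢
    rw [List.getElem?_map, List.getElem?_range hi]
    rfl
  constructor
  · rintro ⟨m, hm⟩
    have hi := (List.getElem?_eq_some_iff.1 hm).1
    exact Option.some.inj ((hval m hi).symm.trans hm)
  · rintro rfl
    obtain ⟨m, hm⟩ := h.2 i
    exact ⟨m, hval m hm⟩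

theorem ConvergesTo.exists_mem_iff {g : List ℕ → List ℕ} {p q : Baire}
    (h : ConvergesTo g p q) {c : ℕ} : (∃ m, c ∈ g (initSeg p m)) ↔ ∃ i, q i = c := by
  simp only [List.mem_iff_getElem?, ← h.exists_getElem?_iff]
  exact exists_comm

theorem NamesOpen.mem_iff {X : Type*} {δ : SetRepresentation X} {r u : Baire} {U : Set X} {x : X}
    (h : NamesOpen δ r U) (hu : δ.Names u x) :
    x ∈ U ↔ ∃ m, 0 ∈ Denumerable.ofNat (List ℕ) (r (Encodable.encode (initSeg u m))) := by
  obtain ⟨q, hq, s, rfl, hs⟩ := h u x hu ⟨_, rfl⟩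
  rw [(mem_limitFun.1 hq).exists_mem_iff]
  exact (iff_of_eq hs).symm

/-- Apply `exists_name` with the zero sequence as a dummy parameter, so that the resulting name is
computable. The functional is first moved to the odd entries, where the pairing puts the point's
name. -/
theorem isCoCEClosed_of_functional {X : Type*} {δ : SetRepresentation X} {B : Set X}
    {T : Baire → ℕ → Bool} (hT : ComputableFunctional T)
    (h : ∀ u x, δ.Names u x → ((∃ e, T u e = true) ↔ x ∉ B)) : IsCoCEClosed δ B := by
  have hsnd : ComputableFunctional fun (u : Baire) (z : ℕ × ℕ) => u (2 * z.2 + 1) :=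
    ComputableFunctional.eval (Computable.succ.comp
      (Primrec.nat_mul.to_comp.comp (Computable.const 2) Computable.snd))
  obtain ⟨Φ, hΦ, hn⟩ := (hT.subst hsnd).exists_name
  have hname : NamesOpen δ (Φ (extendZero [])) Bᶜ := by
    intro u x hu _
    obtain ⟨q, hq, hqT⟩ := hn (extendZero []) u
    refine ⟨q, hq, _, rfl, propext (hqT.trans ?_)⟩
    have : (fun n => pair (extendZero []) u (2 * n + 1)) = u := unpairSnd_pair _ _
    simp only [this]
    exact h u x hu
  refine ⟨⟨_, hname⟩, Φ (extendZero []), ?_, hname⟩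
  exact Computable.comp (f := fun z : List ℕ × ℕ => Φ (extendZero z.1) z.2)
    (g := fun k : ℕ => (([] : List ℕ), k)) hΦ.1 ((Computable.const []).pair Computable.id)

theorem exists_computable_zero_mem :
    ∃ z : ℕ → Bool, Computable z ∧
      ∀ c, z c = true ↔ 0 ∈ Denumerable.ofNat (List ℕ) c := by
  have hp : PrimrecPred fun a : ℕ => a = 0 := Primrec.eq.comp Primrec.id (Primrec.const 0)
  have hd : PrimrecPred fun l : List ℕ => ∃ a ∈ l, a = 0 := hp.exists_mem_list
  refine ⟨fun c => decide (∃ a ∈ Denumerable.ofNat (List ℕ) c, a = 0),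
    hd.decide.to_comp.comp computable_ofNat_list, fun c => ?_⟩
  simp

/-! ### The Cauchy representation -/

section Polish

variable {X : Type*} [MetricSpace X] (c : ComputablePolishSpace X)

theorem primrec_two_pow : Primrec fun n : ℕ => 2 ^ n :=
  (Primrec₂.unpaired'.1 Nat.Primrec.pow).comp (Primrec.const 2) Primrec.id

/-- Strict inequality of computable reals is semidecidable: search for a precision `k` at which the
rational approximation exceeds the bound by more than its error. -/
theorem exists_computable_lt_dist :
    ∃ t : ℕ × ℕ × ℕ × ℕ × ℕ → Bool, Computable t ∧ ∀ i j n m,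
      (∃ k, t (i, j, n, m, k) = true) ↔
        (1 / 2 : ℝ) ^ n + (1 / 2 : ℝ) ^ m < dist (c.α i) (c.α j) := by
  obtain ⟨g, hg, hd⟩ := c.dist_computable
  -- The comparison with the fraction, multiplied by `2 ^ (n + m + k) * (b + 1)` to stay in the
  -- natural numbers.
  let S : (ℕ × ℕ) × ℕ × ℕ × ℕ → Prop := fun z =>
    (2 ^ (z.2.2.1 + z.2.2.2) + 2 ^ (z.2.1 + z.2.2.2) + 2 ^ (z.2.1 + z.2.2.1)) * (z.1.2 + 1) <
      z.1.1 * 2 ^ (z.2.1 + z.2.2.1 + z.2.2.2)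
  have hS : PrimrecPred S := by
    have ha : Primrec fun z : (ℕ × ℕ) × ℕ × ℕ × ℕ => z.1.1 := Primrec.fst.comp Primrec.fst
    have hb : Primrec fun z : (ℕ × ℕ) × ℕ × ℕ × ℕ => z.1.2 := Primrec.snd.comp Primrec.fst
    have h1 : Primrec fun z : (ℕ × ℕ) × ℕ × ℕ × ℕ => z.2.1 := Primrec.fst.comp Primrec.snd
    have h2 : Primrec fun z : (ℕ × ℕ) × ℕ × ℕ × ℕ => z.2.2.1 :=
      Primrec.fst.comp (Primrec.snd.comp Primrec.snd)
    have h3 : Primrec fun z : (ℕ × ℕ) × ℕ × ℕ × ℕ => z.2.2.2 :=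
      Primrec.snd.comp (Primrec.snd.comp Primrec.snd)
    refine Primrec.nat_lt.comp (Primrec.nat_mul.comp (Primrec.nat_add.comp (Primrec.nat_add.comp
      (primrec_two_pow.comp (Primrec.nat_add.comp h2 h3))
      (primrec_two_pow.comp (Primrec.nat_add.comp h1 h3)))
      (primrec_two_pow.comp (Primrec.nat_add.comp h1 h2))) (Primrec.succ.comp hb)) ?_
    exact Primrec.nat_mul.comp ha
      (primrec_two_pow.comp (Primrec.nat_add.comp (Primrec.nat_add.comp h1 h2) h3))
  have hS_iff : ∀ a b n m k : ℕ, S ((a, b), n, m, k) ↔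
      (1 / 2 : ℝ) ^ n + (1 / 2 : ℝ) ^ m + (1 / 2 : ℝ) ^ k < (a : ℝ) / ((b : ℝ) + 1) := by
    intro a b n m k
    have hb : (0 : ℝ) < (b : ℝ) + 1 := by positivity
    have hP : (0 : ℝ) < 2 ^ (n + m + k) := by positivity
    have hn : (1 / 2 : ℝ) ^ n * 2 ^ n = 1 := by rw [← mul_pow]; norm_num
    have hm : (1 / 2 : ℝ) ^ m * 2 ^ m = 1 := by rw [← mul_pow]; norm_num
    have hk : (1 / 2 : ℝ) ^ k * 2 ^ k = 1 := by rw [← mul_pow]; norm_num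
    have hmul : ((1 / 2 : ℝ) ^ n + (1 / 2 : ℝ) ^ m + (1 / 2 : ℝ) ^ k) * ((b : ℝ) + 1) *
        2 ^ (n + m + k) =
        (2 ^ (m + k) + 2 ^ (n + k) + 2 ^ (n + m)) * ((b : ℝ) + 1) := by
      simp only [pow_add]
      linear_combination ((b : ℝ) + 1) * (2 ^ m * 2 ^ k * hn + 2 ^ n * 2 ^ k * hm +
        2 ^ n * 2 ^ m * hk)
    rw [lt_div_iff₀ hb, ← mul_lt_mul_iff_left₀ hP, hmul]
    simp only [S]
    exact_mod_cast Iff.rfl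
  obtain ⟨_, hS'⟩ := hS
  refine ⟨fun z => decide (S (g (z.1, z.2.1, z.2.2.2.2), z.2.2)), ?_, fun i j n m => ?_⟩
  · have hz : Computable fun z : ℕ × ℕ × ℕ × ℕ × ℕ => g (z.1, z.2.1, z.2.2.2.2) :=
      hg.comp (Computable.fst.pair ((Computable.fst.comp Computable.snd).pair
        (Computable.snd.comp (Computable.snd.comp (Computable.snd.comp Computable.snd)))))
    refine (Computable.comp hS'.to_comp
      (hz.pair (Computable.snd.comp Computable.snd))).of_eq fun z => ?_
    exact decide_eq_decide.2 Iff.rfl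
  · simp only [decide_eq_true_eq, hS_iff]
    constructor
    · rintro ⟨k, hk⟩
      have := (abs_le.1 (hd i j k)).1
      linarith
    · intro h
      obtain ⟨k, hk⟩ := exists_pow_lt_of_lt_one (half_pos (sub_pos.2 h))
        (by norm_num : (1 / 2 : ℝ) < 1)
      refine ⟨k, ?_⟩
      have := (abs_le.1 (hd i j k)).2
      linarith

variable {c}

theorem dist_le_of_names {p : Baire} {x : X} (h : (cauchyRepr c).Names p x) (n : ℕ) :
    dist (c.α (p n)) x ≤ (1 / 2 : ℝ) ^ n := by
  refine le_of_tendsto (tendsto_const_nhds.dist h.2) ?_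
  filter_upwards [eventually_gt_atTop n] with i hi
  rw [dist_comm]
  exact (h.1 i n hi).le

/-- The right side involves only dense points, and each failure is a strict inequality of the form
recognised by `exists_computable_lt_dist`. -/
theorem dist_le_iff_of_names {p : Baire} {x : X} (h : (cauchyRepr c).Names p x) (i n : ℕ) :
    dist (c.α i) x ≤ (1 / 2 : ℝ) ^ n ↔
      ∀ m, dist (c.α i) (c.α (p m)) ≤ (1 / 2 : ℝ) ^ n + (1 / 2 : ℝ) ^ m := by
  constructor
  · intro hi m
    have := dist_triangle_right (c.α i) (c.α (p m)) x
    linarith [dist_le_of_names h m]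
  · intro hi
    have h0 : Tendsto (fun m : ℕ => (1 / 2 : ℝ) ^ n + (1 / 2 : ℝ) ^ m) atTop
        (𝓝 ((1 / 2 : ℝ) ^ n + 0)) :=
      tendsto_const_nhds.add
        (tendsto_pow_atTop_nhds_zero_of_lt_one (by norm_num) (by norm_num))
    rw [add_zero] at h0
    exact le_of_tendsto_of_tendsto' (tendsto_const_nhds.dist h.2) h0 hi

/-- The two errors add up to at most `(1 / 2) ^ (j + 1)`, strictly below the required bound. The
hypothesis is a closed condition that can stand in for being a name. -/
theorem names_of_dist_le {p : Baire} {x : X}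
    (h : ∀ n, dist (c.α (p n)) x ≤ (1 / 2 : ℝ) ^ (n + 2)) : (cauchyRepr c).Names p x := by
  constructor
  · intro i j hij
    have h1 : (1 / 2 : ℝ) ^ (i + 2) ≤ (1 / 2 : ℝ) ^ (j + 2) :=
      pow_le_pow_of_le_one (by norm_num) (by norm_num) (by omega)
    have h2 := dist_triangle_right (c.α (p i)) (c.α (p j)) x
    have h3 : (1 / 2 : ℝ) ^ (j + 2) = (1 / 2 : ℝ) ^ j / 4 := by ring
    have h4 : (0 : ℝ) < (1 / 2 : ℝ) ^ j := by positivity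
    linarith [h i, h j]
  · rw [tendsto_iff_dist_tendsto_zero]
    exact squeeze_zero (fun _ => dist_nonneg) h
      ((tendsto_pow_atTop_nhds_zero_of_lt_one (by norm_num) (by norm_num)).comp
        (tendsto_add_atTop_nat 2))

theorem exists_dist_le (x : X) :
    ∃ p : Baire, ∀ n, dist (c.α (p n)) x ≤ (1 / 2 : ℝ) ^ (n + 2) := by
  have h : ∀ n : ℕ, ∃ i, dist x (c.α i) < (1 / 2 : ℝ) ^ (n + 2) := fun n =>
    c.dense.exists_dist_lt x (by positivity)
  choose p hp using h
  exact ⟨p, fun n => by rw [dist_comm]; exact (hp n).le⟩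

theorem exists_names_of_dist_lt {p : Baire}
    (h : ∀ i j, j < i → dist (c.α (p i)) (c.α (p j)) < (1 / 2 : ℝ) ^ j) :
    ∃ x, (cauchyRepr c).Names p x := by
  have := c.complete
  have hcauchy : CauchySeq fun n => c.α (p n) := by
    refine cauchySeq_of_le_geometric (1 / 2) 1 (by norm_num) fun n => ?_
    rw [dist_comm, one_mul]
    exact (h (n + 1) n n.lt_succ_self).le
  obtain ⟨x, hx⟩ := cauchySeq_tendsto_of_complete hcauchy
  exact ⟨x, h, hx⟩

end Polish

/-! ### Reductions to closed choice -/

/-- For each `s` there is a realizer `G s` that answers `s` whenever `s` names a point of the given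
set, and some fixed correct answer otherwise. Applying the reduction to all of them shows that it
succeeds on every correct answer. -/
theorem exists_of_realizes_closedChoice {X Y U : Type*} {δX : SetRepresentation X}
    {δY : SetRepresentation Y} {δU : SetRepresentation U} {f : X → Y} {K H : Baire →. Baire}
    (h : ∀ G : Baire →. Baire, Realizes (negRepr δU) δU G (closedChoice δU) →
      Realizes δX δY (reductionComp K G H) (single f)) {p : Baire} {x : X} (hp : δX.Names p x) :
    ∃ r ∈ H p, ∃ A : Set U, NamesOpen δU r Aᶜ ∧ A.Nonempty ∧
      ∀ s, ∀ a ∈ A, δU.Names s a → ∃ t ∈ K (pair p s), δY.Names t (f x) := by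
  classical
  let G : Baire → Baire →. Baire := fun s r =>
    ⟨∃ A : Set U, NamesOpen δU r Aᶜ ∧ A.Nonempty, fun hr =>
      if ∃ a ∈ hr.choose, δU.Names s a then s else
        (δU.surjective hr.choose_spec.2.choose).choose⟩
  have hG : ∀ s, Realizes (negRepr δU) δU (G s) (closedChoice δU) := by
    intro s r A hA hne
    have hr : ∃ A : Set U, NamesOpen δU r Aᶜ ∧ A.Nonempty := ⟨A.1, hA, hne⟩
    have hAr : hr.choose = A.1 := compl_injective (hr.choose_spec.1.unique hA)
    refine ⟨_, ⟨hr, rfl⟩, ?_⟩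
    by_cases hs : ∃ a ∈ hr.choose, δU.Names s a
    · obtain ⟨a, ha, hsa⟩ := id hs
      refine ⟨a, hAr.subset ha, ?_⟩
      simpa only [G, if_pos hs] using hsa
    · refine ⟨hr.choose_spec.2.choose, hAr.subset hr.choose_spec.2.choose_spec, ?_⟩
      simpa only [G, if_neg hs] using (δU.surjective hr.choose_spec.2.choose).choose_spec
  have key : ∀ s, ∃ r ∈ H p, ∃ s' ∈ G s r, ∃ t ∈ K (pair p s'), δY.Names t (f x) := by
    intro s
    obtain ⟨t, ht, y, rfl, hty⟩ := h (G s) (hG s) p x hp ⟨_, rfl⟩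
    obtain ⟨r, hr, ht⟩ := Part.mem_bind_iff.1 ht
    obtain ⟨s', hs', ht⟩ := Part.mem_bind_iff.1 ht
    exact ⟨r, hr, s', hs', t, ht, hty⟩
  -- The parameter is arbitrary here: `r` depends on `p` alone, and `A` is determined by its name
  -- `r`.
  obtain ⟨r, hr, _, ⟨⟨A, hA, hne⟩, -⟩, -⟩ := key 0
  refine ⟨r, hr, A, hA, hne, fun s a ha hsa => ?_⟩
  obtain ⟨r', hr', s', ⟨hd, hs'⟩, t, ht, hty⟩ := key s
  obtain rfl := Part.mem_unique hr hr'
  have hAr : hd.choose = A := compl_injective (hd.choose_spec.1.unique hA)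
  have hs : ∃ a ∈ hd.choose, δU.Names s a := ⟨a, hAr ▸ ha, hsa⟩
  have : s = s' := by simpa only [G, if_pos hs] using hs'
  exact ⟨t, this ▸ ht, hty⟩

theorem computable_affine {α : Type*} [Primcodable α] {g : α → ℕ} (a b : ℕ) (hg : Computable g) :
    Computable fun z => a * g z + b :=
  Primrec.nat_add.to_comp.comp (Primrec.nat_mul.to_comp.comp (Computable.const a) hg)
    (Computable.const b)

theorem computable_getElem?_test {β : Type*} [Primcodable β] {F : β → List ℕ} {i : β → ℕ}
    {t : β → ℕ → Bool} (hF : Computable F) (hi : Computable i) (ht : Computable₂ t) :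
    Computable fun b => (Option.casesOn (F b)[i b]? false (t b) : Bool) :=
  Computable.option_casesOn (Computable.list_getElem?.comp hF hi) (Computable.const false) ht

theorem casesOn_test_iff {o : Option ℕ} {t : ℕ → Bool} :
    (Option.casesOn o false t : Bool) = true ↔ ∃ c, o = some c ∧ t c = true := by
  cases o <;> simp

/-! ### The two implications for computable Polish spaces -/

section Polish

variable {X Y : Type*} [MetricSpace X] [MetricSpace Y]

open ComputableFunctional

/-- The relation used for the graph of a function that is reducible to closed choice: `v = ⟨p, s⟩`
where `p` is a name of `x`, the sequence `s` is not excluded by the negative information computed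
from `p` by `h`, and every value computed from `v` by `k` is consistent with `y`. -/
def reductionGraph (cX : ComputablePolishSpace X) (cY : ComputablePolishSpace Y)
    (h k : List ℕ → List ℕ) : Set ((X × Y) × Baire) :=
  {z | (∀ n, dist (cX.α (unpairFst z.2 n)) z.1.1 ≤ (1 / 2 : ℝ) ^ (n + 2)) ∧
    (∀ m n c, (h (initSeg (unpairFst z.2) m))[Encodable.encode (initSeg (unpairSnd z.2) n)]? =
      some c → 0 ∉ Denumerable.ofNat (List ℕ) c) ∧
    ∀ m i c, (k (initSeg z.2 m))[i]? = some c → dist (cY.α c) z.1.2 ≤ (1 / 2 : ℝ) ^ i}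

theorem isCoCEClosed_reductionGraph (cX : ComputablePolishSpace X) (cY : ComputablePolishSpace Y)
    {h k : List ℕ → List ℕ} (hh : Computable h) (hk : Computable k) :
    IsCoCEClosed (prodRepr (prodRepr (cauchyRepr cX) (cauchyRepr cY)) baireRepr)
      (reductionGraph cX cY h k) := by
  obtain ⟨tX, htX, hX⟩ := exists_computable_lt_dist cX
  obtain ⟨tY, htY, hY⟩ := exists_computable_lt_dist cY
  obtain ⟨zm, hzm, hz⟩ := exists_computable_zero_mem
  -- Each test searches for a violation of one clause. In a name `u` of `((x, y), ⟨p, s⟩)` the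
  -- entries `4i`, `4i+2`, `4i+1`, `4i+3` belong to `x`, `y`, `p`, `s`, and the entries `2i+1` to
  -- `⟨p, s⟩`.
  let T₁ : Baire → ℕ × ℕ × ℕ × ℕ → Bool := fun u e =>
    tX (u (4 * e.2.1 + 1), u (4 * e.1), e.2.1 + 2, e.1, e.2.2.2)
  let T₂ : Baire → ℕ × ℕ × ℕ × ℕ → Bool := fun u e =>
    Option.casesOn (h (initSeg (fun i => u (4 * i + 1)) e.1))[Encodable.encode
      (initSeg (fun i => u (4 * i + 3)) e.2.1)]? false zm
  let T₃ : Baire → ℕ × ℕ × ℕ × ℕ → Bool := fun u e =>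
    Option.casesOn (k (initSeg (fun i => u (2 * i + 1)) e.1))[e.2.2.1]? false fun c =>
      tY (c, u (4 * e.2.1 + 2), e.2.2.1, e.2.1, e.2.2.2)
  have he1 : Computable fun e : ℕ × ℕ × ℕ × ℕ => e.1 := Computable.fst
  have he2 : Computable fun e : ℕ × ℕ × ℕ × ℕ => e.2.1 := Computable.fst.comp Computable.snd
  have he3 : Computable fun e : ℕ × ℕ × ℕ × ℕ => e.2.2.1 :=
    Computable.fst.comp (Computable.snd.comp Computable.snd)
  have he4 : Computable fun e : ℕ × ℕ × ℕ × ℕ => e.2.2.2 :=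
    Computable.snd.comp (Computable.snd.comp Computable.snd)
  have hT₁ : ComputableFunctional T₁ :=
    map htX ((eval (computable_affine 4 1 he2)).prodMk ((eval (computable_affine 4 0 he1)).prodMk
      (of_computable ((computable_affine 1 2 he2).pair (he1.pair he4)) |>.of_eq fun _ e => by
        rw [one_mul])))
  have hword : ∀ {g : ℕ × ℕ × ℕ × ℕ → ℕ} (a b : ℕ), Computable g →
      ComputableFunctional fun u e => initSeg (fun i => u (a * i + b)) (g e) := fun a b hg =>
    (eval (computable_affine a b Computable.snd)).wordOf hg
  have hT₂ : ComputableFunctional T₂ := by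
    have hF : Computable fun b : List ℕ × List ℕ =>
        (Option.casesOn (h b.1)[Encodable.encode b.2]? false zm : Bool) :=
      computable_getElem?_test (t := fun _ c => zm c) (hh.comp Computable.fst)
        (Computable.encode.comp Computable.snd) (hzm.comp Computable.snd)
    have hG := ((hword 4 1 he1).prodMk (hword 4 3 he2)).map hF
    exact hG
  have hT₃ : ComputableFunctional T₃ := by
    have hF : Computable fun b : List ℕ × ℕ × ℕ × ℕ × ℕ =>
        (Option.casesOn (k b.1)[b.2.2.1]? false fun c => tY (c, b.2) : Bool) :=
      computable_getElem?_test (t := fun (b : List ℕ × ℕ × ℕ × ℕ × ℕ) c => tY (c, b.2))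
        (hk.comp Computable.fst)
        (Computable.fst.comp (Computable.snd.comp Computable.snd))
        (htY.comp (Computable.snd.pair (Computable.snd.comp Computable.fst)))
    have hG := ((hword 2 1 he1).prodMk ((eval (computable_affine 4 2 he2)).prodMk
      (of_computable (he3.pair (he2.pair he4))))).map hF
    exact hG
  obtain ⟨T, hT, hTe⟩ := (map₂ Primrec.or.to_comp hT₁
    (map₂ Primrec.or.to_comp hT₂ hT₃)).exists_nat
  refine isCoCEClosed_of_functional hT fun u z hu => ?_
  obtain ⟨⟨x, y⟩, v⟩ := z
  obtain ⟨⟨hux, huy⟩, huv⟩ := hu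
  obtain rfl : unpairSnd u = v := huv
  have h41 : ∀ i, u (4 * i + 1) = unpairFst (unpairSnd u) i := fun i =>
    congrArg u (by ring)
  have h43 : ∀ i, u (4 * i + 3) = unpairSnd (unpairSnd u) i := fun i =>
    congrArg u (by ring)
  have h40 : ∀ i, u (4 * i) = unpairFst (unpairFst u) i := fun i => congrArg u (by ring)
  have h42 : ∀ i, u (4 * i + 2) = unpairSnd (unpairFst u) i := fun i => congrArg u (by ring)
  have h21 : ∀ i, u (2 * i + 1) = unpairSnd u i := fun _ => rfl
  have hXn : ∀ i n, dist (cX.α i) x ≤ (1 / 2 : ℝ) ^ n ↔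
      ∀ m l, ¬ tX (i, unpairFst (unpairFst u) m, n, m, l) = true := fun i n =>
    (dist_le_iff_of_names hux i n).trans
      (forall_congr' fun m => by rw [← not_lt, ← hX, not_exists])
  have hYn : ∀ i n, dist (cY.α i) y ≤ (1 / 2 : ℝ) ^ n ↔
      ∀ m l, ¬ tY (i, unpairSnd (unpairFst u) m, n, m, l) = true := fun i n =>
    (dist_le_iff_of_names huy i n).trans
      (forall_congr' fun m => by rw [← not_lt, ← hY, not_exists])
  rw [hTe, ← not_iff_not, not_exists, not_not]
  simp only [Bool.or_eq_true, not_or, forall_and, T₁, T₂, T₃, h41, h43, h40, h42, h21,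
    casesOn_test_iff, hz, reductionGraph, Set.mem_ofPred_eq, hXn, hYn, Prod.forall]
  refine and_congr ⟨fun H n m l => H m n 0 l, fun H m n _ l => H n m l⟩
    (and_congr ⟨fun H m n c hc h0 => H m n 0 0 ⟨c, hc, h0⟩,
      fun H m n _ _ ⟨c, hc, h0⟩ => H m n c hc h0⟩
      ⟨fun H m i c hc n l hl => H m n i l ⟨c, hc, hl⟩,
        fun H m n i l ⟨c, hc, hl⟩ => H m i c hc n l hl⟩)

theorem isEffectivelyBorelMeasurable_of_weihrauchLE {cX : ComputablePolishSpace X}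
    {cY : ComputablePolishSpace Y} {f : X → Y}
    (hf : WeihrauchLE (cauchyRepr cX) (cauchyRepr cY) (negRepr baireRepr) baireRepr
      (single f) (closedChoice baireRepr)) : IsEffectivelyBorelMeasurable cX cY f := by
  obtain ⟨_, _, ⟨k, hk, rfl⟩, ⟨h, hh, rfl⟩, hred⟩ := hf
  refine ⟨reductionGraph cX cY h k, isCoCEClosed_reductionGraph cX cY hh hk, ?_⟩
  rintro ⟨x, y⟩
  -- Along a name of `x` the word function `h` converges to a name of the complement of `A`, so not
  -- being excluded by its finite outputs is exactly membership in `A`.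
  have key : ∀ p, (cauchyRepr cX).Names p x → ∃ A : Set Baire, A.Nonempty ∧
      (∀ s, s ∈ A ↔ ∀ m n c, (h (initSeg p m))[Encodable.encode (initSeg s n)]? = some c →
        0 ∉ Denumerable.ofNat (List ℕ) c) ∧
      ∀ s ∈ A, ∃ t, ConvergesTo k (pair p s) t ∧ (cauchyRepr cY).Names t (f x) := by
    intro p hp
    obtain ⟨r, hr, A, hA, hne, hAt⟩ := exists_of_realizes_closedChoice hred hp
    have hr := mem_limitFun.1 hr
    refine ⟨A, hne, fun s => ?_, fun s hs => ?_⟩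
    · rw [← not_iff_not, ← Set.mem_compl_iff, hA.mem_iff rfl]
      push Not
      constructor
      · rintro ⟨n, hn⟩
        obtain ⟨m, hm⟩ := hr.exists_getElem?_iff.2 (rfl : r (Encodable.encode (initSeg s n)) = _)
        exact ⟨m, n, _, hm, hn⟩
      · rintro ⟨m, n, c, hc, h0⟩
        refine ⟨n, ?_⟩
        rwa [hr.exists_getElem?_iff.1 ⟨m, hc⟩]
    · obtain ⟨t, ht, hty⟩ := hAt s s hs rfl
      exact ⟨t, mem_limitFun.1 ht, hty⟩
  constructor
  · intro hxy
    obtain rfl : f x = y := hxy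
    obtain ⟨p, hp⟩ := exists_dist_le (c := cX) x
    obtain ⟨A, ⟨s, hs⟩, hA, hAt⟩ := key p (names_of_dist_le hp)
    obtain ⟨t, ht, hty⟩ := hAt s hs
    refine ⟨pair p s, ?_, ?_, ?_⟩
    · simpa only [unpairFst_pair] using hp
    · simpa only [unpairFst_pair, unpairSnd_pair] using (hA s).1 hs
    · intro m i c hc
      rw [← ht.exists_getElem?_iff.1 ⟨m, hc⟩]
      exact dist_le_of_names hty i
  · rintro ⟨v, hv1, hv2, hv3⟩
    obtain ⟨p, s, rfl⟩ : ∃ p s, v = pair p s := by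
      refine ⟨unpairFst v, unpairSnd v, funext fun n => ?_⟩
      rcases Nat.mod_two_eq_zero_or_one n with hn | hn
      · simp only [pair, hn, if_true, unpairFst]
        congr 1
        omega
      · simp only [pair, hn, one_ne_zero, if_false, unpairSnd]
        congr 1
        omega
    simp only [unpairFst_pair, unpairSnd_pair] at hv1 hv2
    obtain ⟨A, -, hA, hAt⟩ := key p (names_of_dist_le hv1)
    obtain ⟨t, ht, hty⟩ := hAt s ((hA s).2 hv2)
    -- The third clause makes the points named by `t` converge to `y` as well as to `f x`.
    refine tendsto_nhds_unique hty.2 ?_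
    rw [tendsto_iff_dist_tendsto_zero]
    refine squeeze_zero (fun _ => dist_nonneg) (fun i => ?_)
      (tendsto_pow_atTop_nhds_zero_of_lt_one (by norm_num : (0 : ℝ) ≤ 1 / 2) (by norm_num))
    obtain ⟨m, hm⟩ := ht.exists_getElem?_iff.2 (rfl : t i = _)
    exact hv3 m i _ hm

theorem weihrauchLE_of_isEffectivelyBorelMeasurable {cX : ComputablePolishSpace X}
    {cY : ComputablePolishSpace Y} {f : X → Y} (hf : IsEffectivelyBorelMeasurable cX cY f) :
    WeihrauchLE (cauchyRepr cX) (cauchyRepr cY) (negRepr baireRepr) baireRepr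
      (single f) (closedChoice baireRepr) := by
  obtain ⟨B, ⟨_, b, hb, hB⟩, hfB⟩ := hf
  have hB : NamesOpen _ b Bᶜ := hB
  obtain ⟨tY, htY, hY⟩ := exists_computable_lt_dist cY
  obtain ⟨zm, hzm, hz⟩ := exists_computable_zero_mem
  -- Here `u = ⟨p, ⟨q, r⟩⟩`, with `p`, `q`, `r` at the entries `2i`, `4i+1`, `4i+3`. The first test
  -- refutes distances of at most `(1 / 2) ^ (j + 1)`; the second finds a rejection by `B`.
  let T₁ : Baire → ℕ × ℕ × ℕ × ℕ → Bool := fun u e =>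
    decide (e.2.1 < e.1) &&
      tY (u (4 * e.1 + 1), u (4 * e.2.1 + 1), e.2.1 + 2, e.2.1 + 2, e.2.2.1)
  let T₂ : Baire → ℕ × ℕ × ℕ × ℕ → Bool := fun u e =>
    zm (b (Encodable.encode (initSeg
      (pair
        (pair (fun i => u (2 * i)) fun i => u (4 * i + 1))
        fun i => u (4 * i + 3)) e.2.2.2)))
  have he1 : Computable fun e : ℕ × ℕ × ℕ × ℕ => e.1 := Computable.fst
  have he2 : Computable fun e : ℕ × ℕ × ℕ × ℕ => e.2.1 := Computable.fst.comp Computable.snd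
  have he3 : Computable fun e : ℕ × ℕ × ℕ × ℕ => e.2.2.1 :=
    Computable.fst.comp (Computable.snd.comp Computable.snd)
  have he4 : Computable fun e : ℕ × ℕ × ℕ × ℕ => e.2.2.2 :=
    Computable.snd.comp (Computable.snd.comp Computable.snd)
  have hT₁ : ComputableFunctional T₁ := by
    refine map₂ Primrec.and.to_comp
      (of_computable (Primrec.nat_lt.decide.to_comp.comp he2 he1)) (map htY
      ((eval (computable_affine 4 1 he1)).prodMk ((eval (computable_affine 4 1 he2)).prodMk ?_)))
    refine (of_computable ((computable_affine 1 2 he2).pair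
      ((computable_affine 1 2 he2).pair he3))).of_eq fun _ e => ?_
    simp only [one_mul]
  have hT₂ : ComputableFunctional T₂ := by
    have hi : ∀ a c : ℕ, ComputableFunctional fun (u : Baire) (z : (ℕ × ℕ × ℕ × ℕ) × ℕ) =>
        u (a * z.2 + c) := fun a c => eval (computable_affine a c Computable.snd)
    have hw := (((hi 2 0).interleave (hi 4 1)).interleave (hi 4 3)).wordOf he4
    exact map hzm (map hb (map Computable.encode hw))
  obtain ⟨T, hT, hTe⟩ := (map₂ Primrec.or.to_comp hT₁ hT₂).exists_nat
  obtain ⟨Φ, hΦ, hname⟩ := hT.exists_name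
  let A : Baire → Set Baire := fun p => {s | ¬ ∃ e, T (pair p s) e = true}
  -- This holds for every `p`, name or not: the tests only inspect finite words, so `b` need not
  -- converge along the sequences involved.
  have hA : ∀ p, NamesOpen baireRepr (Φ p) (A p)ᶜ := by
    rintro p s _ rfl -
    obtain ⟨q, hq, hqT⟩ := hname p s
    refine ⟨q, hq, _, rfl, propext (hqT.trans ?_)⟩
    simp [A]
  have hA_iff : ∀ p s, s ∈ A p ↔
      (∀ i j, j < i → dist (cY.α (unpairFst s i)) (cY.α (unpairFst s j)) ≤
        (1 / 2 : ℝ) ^ (j + 2) + (1 / 2 : ℝ) ^ (j + 2)) ∧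
      ¬ ∃ m, 0 ∈ Denumerable.ofNat (List ℕ) (b (Encodable.encode (initSeg
        (pair (pair p (unpairFst s)) (unpairSnd s)) m))) := by
    intro p s
    have h41 : ∀ i, pair p s (4 * i + 1) = unpairFst s i := fun i =>
      (congrArg (pair p s) (by ring)).trans
        (congrFun (unpairSnd_pair p s) (2 * i))
    have h43 : ∀ i, pair p s (4 * i + 3) = unpairSnd s i := fun i =>
      (congrArg (pair p s) (by ring)).trans
        (congrFun (unpairSnd_pair p s) (2 * i + 1))
    have h20 : ∀ i, pair p s (2 * i) = p i := congrFun (unpairFst_pair p s)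
    simp only [A, Set.mem_ofPred_eq, hTe, not_exists]
    simp only [Bool.or_eq_true, not_or, forall_and, T₁, T₂, h41, h43, h20, hz,
      ← not_lt, ← hY, Prod.forall, Bool.and_eq_true, decide_eq_true_eq]
    exact and_congr ⟨fun H i j hij ⟨l, hl⟩ => H i j l 0 ⟨hij, hl⟩,
      fun H i j l _ hl => H i j hl.1 ⟨l, hl.2⟩⟩ ⟨fun H m => H 0 0 0 m, fun H _ _ _ m => H m⟩
  have hB_iff : ∀ {p q r x y}, (cauchyRepr cX).Names p x → (cauchyRepr cY).Names q y →
      (((x, y), r) ∈ B ↔ ¬ ∃ m, 0 ∈ Denumerable.ofNat (List ℕ) (b (Encodable.encode (initSeg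
        (pair (pair p q) r) m)))) := by
    intro p q r x y hp hq
    rw [← not_iff_not, not_not, ← Set.mem_compl_iff]
    refine hB.mem_iff ⟨⟨?_, ?_⟩, ?_⟩
    · rwa [unpairFst_pair, unpairFst_pair]
    · rwa [unpairFst_pair, unpairSnd_pair]
    · exact unpairSnd_pair _ _
  refine ⟨fun v => Part.some (unpairFst (unpairSnd v)), fun p => Part.some (Φ p),
    (eval (computable_affine 2 1 (computable_affine 2 0 Computable.id))).isComputableFun,
    hΦ.isComputableFun, ?_⟩
  rintro G hG p x hp -
  have hne : (A p).Nonempty := by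
    obtain ⟨q, hq⟩ := exists_dist_le (c := cY) (f x)
    obtain ⟨r, hr⟩ := (hfB (x, f x)).1 rfl
    refine ⟨pair q r, (hA_iff _ _).2 ?_⟩
    rw [unpairFst_pair, unpairSnd_pair]
    refine ⟨fun i j hij => ?_, (hB_iff hp (names_of_dist_le hq)).1 hr⟩
    have h1 : (1 / 2 : ℝ) ^ (i + 2) ≤ (1 / 2 : ℝ) ^ (j + 2) :=
      pow_le_pow_of_le_one (by norm_num) (by norm_num) (by omega)
    linarith [dist_triangle_right (cY.α (q i)) (cY.α (q j)) (f x), hq i, hq j]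
  obtain ⟨s, hs, _, hsA, rfl⟩ := hG (Φ p) ⟨A p, Φ p, hA p⟩ (hA p) hne
  refine ⟨unpairFst s, ?_, f x, rfl, ?_⟩
  · refine Part.mem_bind (Part.mem_some _) (Part.mem_bind hs ?_)
    exact Part.mem_some_iff.2 (congrArg unpairFst (unpairSnd_pair p s).symm)
  · obtain ⟨hs1, hs2⟩ := (hA_iff p s).1 hsA
    -- Completeness of `Y` enters here: the chosen sequence names some point before that point is
    -- known to be `f x`.
    obtain ⟨y, hy⟩ := exists_names_of_dist_lt (c := cY) (p := unpairFst s) fun i j hij => by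
      have h4 : (0 : ℝ) < (1 / 2 : ℝ) ^ j := by positivity
      have h3 : (1 / 2 : ℝ) ^ (j + 2) = (1 / 2 : ℝ) ^ j / 4 := by ring
      linarith [hs1 i j hij]
    have hxy : f x = y := (hfB (x, y)).2 ⟨_, (hB_iff hp hy).2 hs2⟩
    exact hxy ▸ hy

end Polish

end ComputableAnalysis

theorem mainTheorem4 {X : Type*} {Y : Type*} [MetricSpace X] [MetricSpace Y]
    (cX : ComputablePolishSpace X) (cY : ComputablePolishSpace Y) (f : X → Y) :
    WeihrauchLE (cauchyRepr cX) (cauchyRepr cY) (negRepr baireRepr) baireRepr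
        (single f) (closedChoice baireRepr) ↔
      IsEffectivelyBorelMeasurable cX cY f :=
  ⟨isEffectivelyBorelMeasurable_of_weihrauchLE, weihrauchLE_of_isEffectivelyBorelMeasurable⟩
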